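/- Let $\mathbf U=\mathbf U_v(\mathfrak{gl}_2)$ be the $\mathbb Q(v)$-algebra with generators $e,f,K_1^{\pm1},K_2^{\pm1}$ and relations $K_1K_2=K_2K_1$, $K_iK_i^{-1}=K_i^{-1}K_i=1$ $(i=1,2)$, $K_1eK_1^{-1}=ve$, $K_1fK_1^{-1}=v^{-1}f$, $K_2eK_2^{-1}=v^{-1}e$, $K_2fK_2^{-1}=vf$, and $$ef-fe=\frac{K_1K_2^{-1}-K_1^{-1}K_2}{v-v^{-1}}.$$ It is a bialgebra with comultiplication $\Delta(e)=e\otimes1+K_1K_2^{-1}\otimes e$, $\Delta(f)=f\otimes K_1^{-1}K_2+1\otimes f$, $\Delta(K_i)=K_i\otimes K_i$ and counit $e,f\mapsto 0$, $K_i\mapsto1$. Let $E=\mathbb Q(v)^2$ be the $\mathbf U$-module on which $$e\mapsto\begin{pmatrix}0&1\\0&0\end{pmatrix},\quad f\mapsto\begin{pmatrix}0&0\\1&0\end{pmatrix},\quad K_1\mapsto\begin{pmatrix}v&0\\0&1\end{pmatrix},\quad K_2\mapsto\begin{pmatrix}1&0\\0&v\end{pmatrix}.$$ For an integer $d\ge0$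 let $\rho_d:\mathbf U\to\operatorname{End}_{\mathbb Q(v)}(E^{\otimes d})$ be the representation on the $d$-th tensor power obtained from the iterated comultiplication (from the counit if $d=0$), and let the quantum Schur algebra $S_v(2,d)$ be the image of $\rho_d$. Theorem. For every $d\ge0$, the $\mathbb Q(v)$-algebra $S_v(2,d)$ is isomorphic to the (unital associative) $\mathbb Q(v)$-algebra generated by $e,f,K^{\pm1}$ subject to the relations \begin{align*} &KK^{-1}=K^{-1}K=1,\\ &KeK^{-1}=v^2e,\qquad KfK^{-1}=v^{-2}f,\\ &ef-fe=\frac{K-K^{-1}}{v-v^{-1}},\\ &(K-v^d)(K-v^{d-2})\cdots(K-v^{-d+2})(K-v^{-d})=0. \end{align*} More precisely, there is an isomorphism from this algebra onto $S_v(2,d)$ which sends $e,f,K,K^{-1}$ to $\rho_d(e),\rho_d(f),\rho_d(K_1K_2^{-1}),\rho_d(K_1^{-1}K_2)$. -/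

import Mathlib

open scoped TensorProduct

noncomputable section

namespace QSchur

/-- The ground field `ℚ(v)`. -/
abbrev Qv : Type := RatFunc ℚ

/-- The indeterminate `v` of `ℚ(v)`. -/
def v : Qv := RatFunc.X

lemma v_ne_zero : v ≠ 0 := RatFunc.X_ne_zero

/-! ### The quantized enveloping algebra of `gl₂` -/

/-- The generators `e, f, K₁, K₁⁻¹, K₂, K₂⁻¹`. -/
inductive GlGen : Type
  | e | f | K1 | K1inv | K2 | K2inv

/-- A generator, as an element of the free algebra. -/
abbrev glι (x : GlGen) : FreeAlgebra Qv GlGen := FreeAlgebra.ι Qv x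

open GlGen in
/-- The defining relations of `U_v(gl₂)`. -/
inductive GlRel : FreeAlgebra Qv GlGen → FreeAlgebra Qv GlGen → Prop
  | K1_K2 : GlRel (glι K1 * glι K2) (glι K2 * glι K1)
  | K1_K1inv : GlRel (glι K1 * glι K1inv) 1
  | K1inv_K1 : GlRel (glι K1inv * glι K1) 1
  | K2_K2inv : GlRel (glι K2 * glι K2inv) 1
  | K2inv_K2 : GlRel (glι K2inv * glι K2) 1
  | K1_e : GlRel (glι K1 * glι e * glι K1inv) (v • glι e)
  | K1_f : GlRel (glι K1 * glι f * glι K1inv) (v⁻¹ • glι f)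
  | K2_e : GlRel (glι K2 * glι e * glι K2inv) (v⁻¹ • glι e)
  | K2_f : GlRel (glι K2 * glι f * glι K2inv) (v • glι f)
  | e_f : GlRel (glι e * glι f - glι f * glι e)
      ((v - v⁻¹)⁻¹ • (glι K1 * glι K2inv - glι K1inv * glι K2))

/-- The quantized enveloping algebra `U_v(gl₂)` over `ℚ(v)`. -/
abbrev U : Type := RingQuot GlRel

/-- A generator, as an element of `U_v(gl₂)`. -/
def gl (x : GlGen) : U := RingQuot.mkAlgHom Qv GlRel (glι x)

section lift

variable {A : Type*} [Ring A] [Algebra Qv A]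

/-- Elements of a `ℚ(v)`-algebra which satisfy the defining relations of `U_v(gl₂)`. -/
structure IsGlFamily (a : GlGen → A) : Prop where
  K1_K2 : a .K1 * a .K2 = a .K2 * a .K1
  K1_K1inv : a .K1 * a .K1inv = 1
  K1inv_K1 : a .K1inv * a .K1 = 1
  K2_K2inv : a .K2 * a .K2inv = 1
  K2inv_K2 : a .K2inv * a .K2 = 1
  K1_e : a .K1 * a .e * a .K1inv = v • a .e
  K1_f : a .K1 * a .f * a .K1inv = v⁻¹ • a .f
  K2_e : a .K2 * a .e * a .K2inv = v⁻¹ • a .e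
  K2_f : a .K2 * a .f * a .K2inv = v • a .f
  e_f : a .e * a .f - a .f * a .e =
    (v - v⁻¹)⁻¹ • (a .K1 * a .K2inv - a .K1inv * a .K2)

/-- The algebra homomorphism from `U_v(gl₂)` determined by images of the generators. -/
def liftU (a : GlGen → A) (h : IsGlFamily a) : U →ₐ[Qv] A :=
  RingQuot.liftAlgHom Qv ⟨FreeAlgebra.lift Qv a, by
    intro x y hxy
    cases hxy
    · simpa using h.K1_K2
    · simpa using h.K1_K1inv
    · simpa using h.K1inv_K1
    · simpa using h.K2_K2inv
    · simpa using h.K2inv_K2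
    · simpa using h.K1_e
    · simpa using h.K1_f
    · simpa using h.K2_e
    · simpa using h.K2_f
    · simpa using h.e_f⟩

@[simp] lemma liftU_gl (a : GlGen → A) (h : IsGlFamily a) (x : GlGen) :
    liftU a h (gl x) = a x := by
  simp [liftU, gl]

lemma algHom_ext {B : Type*} [Semiring B] [Algebra Qv B] {φ ψ : U →ₐ[Qv] B}
    (h : ∀ x, φ (gl x) = ψ (gl x)) : φ = ψ := by
  apply RingQuot.ringQuot_ext'
  apply FreeAlgebra.hom_ext
  funext x
  exact h x

end lift

lemma gl_isGlFamily : IsGlFamily gl where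
  K1_K2 := by simpa [gl] using RingQuot.mkAlgHom_rel Qv GlRel.K1_K2
  K1_K1inv := by simpa [gl] using RingQuot.mkAlgHom_rel Qv GlRel.K1_K1inv
  K1inv_K1 := by simpa [gl] using RingQuot.mkAlgHom_rel Qv GlRel.K1inv_K1
  K2_K2inv := by simpa [gl] using RingQuot.mkAlgHom_rel Qv GlRel.K2_K2inv
  K2inv_K2 := by simpa [gl] using RingQuot.mkAlgHom_rel Qv GlRel.K2inv_K2
  K1_e := by simpa [gl] using RingQuot.mkAlgHom_rel Qv GlRel.K1_e
  K1_f := by simpa [gl] using RingQuot.mkAlgHom_rel Qv GlRel.K1_f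
  K2_e := by simpa [gl] using RingQuot.mkAlgHom_rel Qv GlRel.K2_e
  K2_f := by simpa [gl] using RingQuot.mkAlgHom_rel Qv GlRel.K2_f
  e_f := by simpa [gl] using RingQuot.mkAlgHom_rel Qv GlRel.e_f

/-! ### The bialgebra structure -/

/-- The values of the comultiplication on the generators, with `K = K₁ K₂⁻¹`:
`Δ e = e ⊗ 1 + K ⊗ e`, `Δ f = f ⊗ K⁻¹ + 1 ⊗ f`, `Δ Kᵢ = Kᵢ ⊗ Kᵢ`. -/
def comulGen : GlGen → U ⊗[Qv] U
  | .e => gl .e ⊗ₜ 1 + (gl .K1 * gl .K2inv) ⊗ₜ gl .e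
  | .f => gl .f ⊗ₜ (gl .K1inv * gl .K2) + 1 ⊗ₜ gl .f
  | .K1 => gl .K1 ⊗ₜ gl .K1
  | .K1inv => gl .K1inv ⊗ₜ gl .K1inv
  | .K2 => gl .K2 ⊗ₜ gl .K2
  | .K2inv => gl .K2inv ⊗ₜ gl .K2inv

section commute

variable {A : Type*} [Ring A] [Algebra Qv A]

lemma mul_eq_of_conj {k k' x : A} {c : Qv} (hk : k' * k = 1) (h : k * x * k' = c • x) :
    k * x = c • (x * k) := by
  calc k * x = k * x * (k' * k) := by rw [hk, mul_one]
    _ = (k * x * k') * k := by simp only [mul_assoc]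
    _ = c • (x * k) := by rw [h, smul_mul_assoc]

lemma inv_mul_eq_of_conj {k k' x : A} {c : Qv} (hc : c ≠ 0) (hk : k' * k = 1)
    (hk' : k * k' = 1) (h : k * x * k' = c • x) :
    k' * x = c⁻¹ • (x * k') := by
  have h1 := mul_eq_of_conj hk h
  have h2 : x * k' = c • (k' * x) := by
    calc x * k' = k' * k * x * k' := by rw [hk, one_mul]
      _ = k' * (k * x) * k' := by simp only [mul_assoc]
      _ = c • (k' * x * (k * k')) := by
        rw [h1, mul_smul_comm, smul_mul_assoc]; simp only [mul_assoc]
      _ = c • (k' * x) := by rw [hk', mul_one]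
  rw [h2, smul_smul, inv_mul_cancel₀ hc, one_smul]

end commute

section K

variable {A : Type*} [Ring A] [Algebra Qv A] {a : GlGen → A}

lemma IsGlFamily.comm_K1_K2inv (h : IsGlFamily a) : a .K1 * a .K2inv = a .K2inv * a .K1 := by
  calc a .K1 * a .K2inv = (a .K2inv * a .K2) * a .K1 * a .K2inv := by rw [h.K2inv_K2, one_mul]
    _ = a .K2inv * (a .K1 * a .K2) * a .K2inv := by rw [h.K1_K2]; simp only [mul_assoc]
    _ = a .K2inv * a .K1 * (a .K2 * a .K2inv) := by simp only [mul_assoc]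
    _ = a .K2inv * a .K1 := by rw [h.K2_K2inv, mul_one]

lemma IsGlFamily.K_Kinv (h : IsGlFamily a) :
    (a .K1 * a .K2inv) * (a .K1inv * a .K2) = 1 := by
  calc (a .K1 * a .K2inv) * (a .K1inv * a .K2)
      = a .K2inv * (a .K1 * a .K1inv) * a .K2 := by
        rw [h.comm_K1_K2inv]; simp only [mul_assoc]
    _ = 1 := by rw [h.K1_K1inv, mul_one, h.K2inv_K2]

lemma IsGlFamily.Kinv_K (h : IsGlFamily a) :
    (a .K1inv * a .K2) * (a .K1 * a .K2inv) = 1 := by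
  calc (a .K1inv * a .K2) * (a .K1 * a .K2inv)
      = a .K1inv * (a .K1 * a .K2) * a .K2inv := by
        rw [h.K1_K2]; simp only [mul_assoc]
    _ = (a .K1inv * a .K1) * (a .K2 * a .K2inv) := by simp only [mul_assoc]
    _ = 1 := by rw [h.K1inv_K1, h.K2_K2inv, mul_one]

lemma IsGlFamily.K_f (h : IsGlFamily a) :
    (a .K1 * a .K2inv) * a .f = (v⁻¹ * v⁻¹) • (a .f * (a .K1 * a .K2inv)) := by
  have h1 := inv_mul_eq_of_conj v_ne_zero h.K2inv_K2 h.K2_K2inv h.K2_f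
  have h2 := mul_eq_of_conj h.K1inv_K1 h.K1_f
  rw [mul_assoc, h1, mul_smul_comm, ← mul_assoc, h2, smul_mul_assoc, smul_smul, mul_assoc]

lemma IsGlFamily.Kinv_e (h : IsGlFamily a) :
    (a .K1inv * a .K2) * a .e = (v⁻¹ * v⁻¹) • (a .e * (a .K1inv * a .K2)) := by
  have h1 := inv_mul_eq_of_conj v_ne_zero h.K1inv_K1 h.K1_K1inv h.K1_e
  have h2 := mul_eq_of_conj h.K2inv_K2 h.K2_e
  rw [mul_assoc, h2, mul_smul_comm, ← mul_assoc, h1, smul_mul_assoc, smul_smul, mul_assoc]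

end K

lemma comulGen_isGlFamily : IsGlFamily comulGen := by
  have H := gl_isGlFamily
  have cancel : ∀ {x y : U}, x * y = 1 → ∀ z, x * (y * z) = z := fun h z => by
    rw [← mul_assoc, h, one_mul]
  have K1K : gl .K1 * (gl .K1 * gl .K2inv) * gl .K1inv = gl .K1 * gl .K2inv := by
    calc gl .K1 * (gl .K1 * gl .K2inv) * gl .K1inv
        = gl .K1 * gl .K2inv * (gl .K1 * gl .K1inv) := by
          rw [H.comm_K1_K2inv]; simp only [← mul_assoc]; rw [H.comm_K1_K2inv]
      _ = _ := by rw [H.K1_K1inv, mul_one]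
  have K2K : gl .K2 * (gl .K1 * gl .K2inv) * gl .K2inv = gl .K1 * gl .K2inv := by
    rw [← mul_assoc, ← H.K1_K2, mul_assoc (gl .K1), H.K2_K2inv, mul_one]
  have K1K' : gl .K1 * (gl .K1inv * gl .K2) * gl .K1inv = gl .K1inv * gl .K2 := by
    have : gl .K1inv * gl .K2 = gl .K2 * gl .K1inv := by
      calc gl .K1inv * gl .K2 = gl .K1inv * (gl .K2 * gl .K1) * gl .K1inv := by
            rw [mul_assoc, mul_assoc, H.K1_K1inv, mul_one]
        _ = (gl .K1inv * gl .K1) * gl .K2 * gl .K1inv := by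
            rw [← H.K1_K2]; simp only [mul_assoc]
        _ = gl .K2 * gl .K1inv := by rw [H.K1inv_K1, one_mul]
    rw [← mul_assoc, H.K1_K1inv, one_mul, this]
  have K2K' : gl .K2 * (gl .K1inv * gl .K2) * gl .K2inv = gl .K1inv * gl .K2 := by
    have : gl .K1inv * gl .K2 = gl .K2 * gl .K1inv := by
      calc gl .K1inv * gl .K2 = gl .K1inv * (gl .K2 * gl .K1) * gl .K1inv := by
            rw [mul_assoc, mul_assoc, H.K1_K1inv, mul_one]
        _ = (gl .K1inv * gl .K1) * gl .K2 * gl .K1inv := by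
            rw [← H.K1_K2]; simp only [mul_assoc]
        _ = gl .K2 * gl .K1inv := by rw [H.K1inv_K1, one_mul]
    calc gl .K2 * (gl .K1inv * gl .K2) * gl .K2inv
        = gl .K2 * gl .K1inv * (gl .K2 * gl .K2inv) := by simp only [mul_assoc]
      _ = _ := by rw [H.K2_K2inv, mul_one, this]
  constructor
  · simp only [comulGen, Algebra.TensorProduct.tmul_mul_tmul, H.K1_K2]
  · simp only [comulGen, Algebra.TensorProduct.tmul_mul_tmul, H.K1_K1inv,
      Algebra.TensorProduct.one_def]
  · simp only [comulGen, Algebra.TensorProduct.tmul_mul_tmul, H.K1inv_K1,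
      Algebra.TensorProduct.one_def]
  · simp only [comulGen, Algebra.TensorProduct.tmul_mul_tmul, H.K2_K2inv,
      Algebra.TensorProduct.one_def]
  · simp only [comulGen, Algebra.TensorProduct.tmul_mul_tmul, H.K2inv_K2,
      Algebra.TensorProduct.one_def]
  · simp only [comulGen, mul_add, add_mul, Algebra.TensorProduct.tmul_mul_tmul, mul_one,
      H.K1_e, H.K1_K1inv, K1K, smul_add, TensorProduct.smul_tmul', TensorProduct.tmul_smul]
  · simp only [comulGen, mul_add, add_mul, Algebra.TensorProduct.tmul_mul_tmul, mul_one,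
      H.K1_f, H.K1_K1inv, K1K', smul_add, TensorProduct.smul_tmul', TensorProduct.tmul_smul]
  · simp only [comulGen, mul_add, add_mul, Algebra.TensorProduct.tmul_mul_tmul, mul_one,
      H.K2_e, H.K2_K2inv, K2K, smul_add, TensorProduct.smul_tmul', TensorProduct.tmul_smul]
  · simp only [comulGen, mul_add, add_mul, Algebra.TensorProduct.tmul_mul_tmul, mul_one,
      H.K2_f, H.K2_K2inv, K2K', smul_add, TensorProduct.smul_tmul', TensorProduct.tmul_smul]
  · have hcross : (gl .K1 * gl .K2inv * gl .f) ⊗ₜ[Qv] (gl .e * (gl .K1inv * gl .K2)) =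
        (gl .f * (gl .K1 * gl .K2inv)) ⊗ₜ[Qv] (gl .K1inv * gl .K2 * gl .e) := by
      rw [H.K_f, H.Kinv_e, TensorProduct.smul_tmul]
    have e1 : (gl .e * gl .f) ⊗ₜ[Qv] (gl .K1inv * gl .K2) =
        (gl .f * gl .e) ⊗ₜ (gl .K1inv * gl .K2) + (v - v⁻¹)⁻¹ •
          ((gl .K1 * gl .K2inv) ⊗ₜ (gl .K1inv * gl .K2) -
            (gl .K1inv * gl .K2) ⊗ₜ (gl .K1inv * gl .K2)) := by
      rw [← TensorProduct.sub_tmul, TensorProduct.smul_tmul', ← H.e_f, ← TensorProduct.add_tmul,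
        add_sub_cancel]
    have e2 : (gl .K1 * gl .K2inv) ⊗ₜ[Qv] (gl .e * gl .f) =
        (gl .K1 * gl .K2inv) ⊗ₜ (gl .f * gl .e) + (v - v⁻¹)⁻¹ •
          ((gl .K1 * gl .K2inv) ⊗ₜ (gl .K1 * gl .K2inv) -
            (gl .K1 * gl .K2inv) ⊗ₜ (gl .K1inv * gl .K2)) := by
      rw [← TensorProduct.tmul_sub, ← TensorProduct.tmul_smul, ← H.e_f,
        ← TensorProduct.tmul_add, add_sub_cancel]
    simp only [comulGen, mul_add, add_mul, Algebra.TensorProduct.tmul_mul_tmul, mul_one, one_mul,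
      hcross, e1, e2, smul_sub]
    abel

/-- The comultiplication `Δ : U → U ⊗ U`. -/
def comul : U →ₐ[Qv] U ⊗[Qv] U := liftU comulGen comulGen_isGlFamily

/-- The values of the counit on the generators. -/
def counitGen : GlGen → Qv
  | .e => 0
  | .f => 0
  | .K1 => 1
  | .K1inv => 1
  | .K2 => 1
  | .K2inv => 1

lemma counitGen_isGlFamily : IsGlFamily counitGen := by
  constructor <;> simp [counitGen]

/-- The counit `ε : U → ℚ(v)`. -/
def counit : U →ₐ[Qv] Qv := liftU counitGen counitGen_isGlFamily

/-- `U_v(gl₂)` with `comul` and `counit` is a bialgebra. -/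
@[reducible] def bialgebra : Bialgebra Qv U :=
  Bialgebra.ofAlgHom comul counit
    (by
      apply algHom_ext
      rintro (_ | _ | _ | _ | _ | _) <;>
        simp [comul, comulGen, TensorProduct.add_tmul, TensorProduct.tmul_add, add_assoc,
          Algebra.TensorProduct.one_def])
    (by
      apply algHom_ext
      rintro (_ | _ | _ | _ | _ | _) <;>
        simp [comul, comulGen, counit, counitGen])
    (by
      apply algHom_ext
      rintro (_ | _ | _ | _ | _ | _) <;>
        simp [comul, comulGen, counit, counitGen])

/-! ### The representations on tensor powers -/

/-- The natural module `E`, with standard basis `e₁, e₂`. -/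
abbrev E : Type := Fin 2 → Qv

/-- The matrices by which the generators act on `E`. -/
def vecGen : GlGen → Matrix (Fin 2) (Fin 2) Qv
  | .e => !![0, 1; 0, 0]
  | .f => !![0, 0; 1, 0]
  | .K1 => !![v, 0; 0, 1]
  | .K1inv => !![v⁻¹, 0; 0, 1]
  | .K2 => !![1, 0; 0, v]
  | .K2inv => !![1, 0; 0, v⁻¹]

lemma v_sub_inv_ne_zero : v - v⁻¹ ≠ 0 := by
  intro h
  have h1 : v * v = 1 := by
    have := sub_eq_zero.mp h
    nth_rewrite 2 [this]
    exact mul_inv_cancel₀ v_ne_zero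
  have h2 : (Polynomial.X * Polynomial.X : Polynomial ℚ) = 1 := by
    apply RatFunc.algebraMap_injective ℚ
    simpa [v] using h1
  have := congrArg (Polynomial.eval 0) h2
  simp at this

lemma vecGen_isGlFamily : IsGlFamily vecGen := by
  have h := v_ne_zero
  have h' := v_sub_inv_ne_zero
  constructor <;> ext i j <;> fin_cases i <;> fin_cases j <;>
    simp [vecGen, h]
  · exact (inv_mul_cancel₀ h').symm
  · rw [← neg_sub v, mul_neg, inv_mul_cancel₀ h']

/-- The natural representation `ρ : U → End(E)`. -/
def rho : U →ₐ[Qv] Module.End Qv E :=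
  (Matrix.toLinAlgEquiv' : Matrix (Fin 2) (Fin 2) Qv ≃ₐ[Qv] _).toAlgHom.comp
    (liftU vecGen vecGen_isGlFamily)

/-- The tensor product of two representations, through the comultiplication. -/
def tensorRep {V W : Type} [AddCommGroup V] [Module Qv V] [AddCommGroup W] [Module Qv W]
    (φ : U →ₐ[Qv] Module.End Qv V) (ψ : U →ₐ[Qv] Module.End Qv W) :
    U →ₐ[Qv] Module.End Qv (V ⊗[Qv] W) :=
  (Module.endTensorEndAlgHom.comp (Algebra.TensorProduct.map φ ψ)).comp comul

/-- The canonical isomorphism `E^{⊗ d} ⊗ E ≃ E^{⊗ (d + 1)}`. -/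
def tensorPowerSucc (d : ℕ) : (⨂[Qv]^d E) ⊗[Qv] E ≃ₗ[Qv] (⨂[Qv]^(d + 1) E) :=
  (TensorProduct.congr (LinearEquiv.refl Qv (⨂[Qv]^d E))
    (PiTensorProduct.subsingletonEquiv (s := fun _ : Fin 1 => E) 0).symm).trans
      TensorPower.mulEquiv

/-- The representation `ρ_d : U → End(E^{⊗ d})`: the trivial one, given by the counit, for
`d = 0`, and `ρ_{d+1} = (ρ_d ⊗ ρ) ∘ Δ` on `E^{⊗ (d+1)} = E^{⊗ d} ⊗ E`. -/
def rhoD : (d : ℕ) → U →ₐ[Qv] Module.End Qv (⨂[Qv]^d E)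
  | 0 => (Algebra.ofId Qv _).comp counit
  | d + 1 => ((tensorPowerSucc d).conjAlgEquiv Qv).toAlgHom.comp (tensorRep (rhoD d) rho)

/-- The quantum Schur algebra `S_v(2,d)`: the image of `ρ_d`. -/
def SchurAlgebra (d : ℕ) : Subalgebra Qv (Module.End Qv (⨂[Qv]^d E)) := (rhoD d).range

/-- The surjection of `U` onto the quantum Schur algebra. -/
def toSchur (d : ℕ) : U →ₐ[Qv] SchurAlgebra d := (rhoD d).rangeRestrict

/-! ### The presented algebra -/

/-- The generators `e, f, K, K⁻¹`. -/
inductive SlGen : Type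
  | e | f | K | Kinv

/-- A generator, as an element of the free algebra. -/
abbrev slι (x : SlGen) : FreeAlgebra Qv SlGen := FreeAlgebra.ι Qv x

open SlGen in
/-- The relations of `U_v(sl₂)` and `(K - v^d)(K - v^{d-2}) ⋯ (K - v^{-d}) = 0`. -/
inductive SlRel (d : ℕ) : FreeAlgebra Qv SlGen → FreeAlgebra Qv SlGen → Prop
  | K_Kinv : SlRel d (slι K * slι Kinv) 1
  | Kinv_K : SlRel d (slι Kinv * slι K) 1
  | K_e : SlRel d (slι K * slι e * slι Kinv) (v ^ 2 • slι e)
  | K_f : SlRel d (slι K * slι f * slι Kinv) (v ^ (-2 : ℤ) • slι f)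
  | e_f : SlRel d (slι e * slι f - slι f * slι e) ((v - v⁻¹)⁻¹ • (slι K - slι Kinv))
  | prod_K : SlRel d ((List.range (d + 1)).map fun i : ℕ =>
      slι K - algebraMap Qv _ (v ^ ((d : ℤ) - 2 * (i : ℤ)))).prod 0

/-- The algebra with generators `e, f, K, K⁻¹` and the relations `SlRel d`. -/
abbrev Presented (d : ℕ) : Type := RingQuot (SlRel d)

/-- A generator, as an element of the presented algebra. -/
def sl (d : ℕ) (x : SlGen) : Presented d := RingQuot.mkAlgHom Qv (SlRel d) (slι x)

end QSchur

end

noncomputable section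

namespace QSchur

/-! ### The parameter `v` is not a root of unity -/

/-! The tensor power is spanned by vectors of weight (a, b) with a + b = d (`span_isWeight`), on
which K₁K₂⁻¹ acts by v^(d-2b). Hence the product relation holds there and the presented algebra acts
(`presentedRep`). As v is not a root of unity, these eigenvalues are distinct, so K₁, K₂ and their
inverses, whose scalars depend only on b, are interpolation polynomials in K₁K₂⁻¹; this gives
surjectivity.

For injectivity, the product relation splits 1 into idempotents 1_j = `idem d j`, the Lagrange basis
polynomials evaluated at K. Let I_j be the two-sided ideal generated by the 1_i with i < j, so that
I_0 = 0 and I_(d+1) is everything. Modulo I_j, the element 1_j is a highest weight vector of weight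
d - 2j from the left, and symmetrically from the right. The usual sl₂ computation then shows that
I_(j+1) is spanned modulo I_j by the elements f^a 1_j e^b with 0 ≤ a, b ≤ d - 2j
(`idemIdeal_succ_le`).

These elements are separated by the tensor power. If 2j ≤ d, it contains a highest weight vector w
of weight (d - j, j) (`exists_highest_weight`). The ideal I_j kills the submodule generated by w,
and f^a 1_j e^b sends f^b w to a nonzero multiple of f^a w and kills the other f^c w with c ≤ d -
2j: up to scalars, matrix units. So an element of I_(j+1) acting by zero lies in I_j
(`mem_idemIdeal_of_apply_eq_zero`), and descending from I_(d+1) to I_0 makes it zero. No dimension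
count is needed. -/

lemma v_pow_ne_one {n : ℕ} (hn : n ≠ 0) : v ^ n ≠ 1 := by
  intro h
  have h2 : (Polynomial.X ^ n : Polynomial ℚ) = 1 := by
    apply RatFunc.algebraMap_injective ℚ
    simpa [v] using h
  have := congrArg Polynomial.natDegree h2
  simp at this
  exact hn this

lemma v_zpow_eq_one {m : ℤ} (h : v ^ m = 1) : m = 0 := by
  by_contra hm
  have hn : m.natAbs ≠ 0 := by omega
  rcases Int.natAbs_eq m with h' | h' <;> rw [h'] at h
  · exact v_pow_ne_one hn (by rwa [zpow_natCast] at h)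
  · exact v_pow_ne_one hn (by rwa [zpow_neg, zpow_natCast, inv_eq_one] at h)

lemma v_zpow_injective : Function.Injective fun m : ℤ => v ^ m := by
  intro m n h
  have : v ^ (m - n) = 1 := by
    rw [zpow_sub₀ v_ne_zero]
    exact (div_eq_one_iff_eq (zpow_ne_zero _ v_ne_zero)).2 h
  have := v_zpow_eq_one this
  omega

lemma v_zpow_sub_zpow_neg_ne_zero {m : ℤ} (hm : m ≠ 0) : v ^ m - v ^ (-m) ≠ 0 := by
  intro h
  have := v_zpow_injective (sub_eq_zero.1 h)
  omega

lemma eq_zero_of_v_zpow_smul_eq {M : Type*} [AddCommGroup M] [Module Qv M] {m n : ℤ}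
    (hmn : m ≠ n) {x : M} (h : v ^ m • x = v ^ n • x) : x = 0 := by
  rw [← sub_eq_zero, ← sub_smul, smul_eq_zero, sub_eq_zero] at h
  exact h.resolve_left (v_zpow_injective.ne hmn)

/-! ### Families satisfying the relations of quantum `sl₂` -/

/-- Elements of an algebra which satisfy the defining relations of `U_v(sl₂)`. -/
structure IsSlFamily {A : Type*} [Ring A] [Algebra Qv A] (e f k k' : A) : Prop where
  k_k' : k * k' = 1
  k'_k : k' * k = 1
  k_e : k * e = v ^ (2 : ℤ) • (e * k)
  k_f : k * f = v ^ (-2 : ℤ) • (f * k)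
  e_f : e * f - f * e = (v - v⁻¹)⁻¹ • (k - k')

lemma IsSlFamily.map {A B : Type*} [Ring A] [Algebra Qv A] [Ring B] [Algebra Qv B]
    {e f k k' : A} (h : IsSlFamily e f k k') (φ : A →ₐ[Qv] B) :
    IsSlFamily (φ e) (φ f) (φ k) (φ k') where
  k_k' := by rw [← map_mul, h.k_k', map_one]
  k'_k := by rw [← map_mul, h.k'_k, map_one]
  k_e := by rw [← map_mul, h.k_e, map_smul, map_mul]
  k_f := by rw [← map_mul, h.k_f, map_smul, map_mul]
  e_f := by simp only [← map_mul, ← map_sub, h.e_f, map_smul]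

/-- Turns the algebra into a representation of itself, so that statements about weight vectors apply
to the idempotents. -/
lemma IsSlFamily.mulLeft {A : Type*} [Ring A] [Algebra Qv A] {e f k k' : A}
    (h : IsSlFamily e f k k') :
    IsSlFamily (LinearMap.mulLeft Qv e) (LinearMap.mulLeft Qv f)
      (LinearMap.mulLeft Qv k) (LinearMap.mulLeft Qv k') :=
  h.map (Algebra.lmul Qv A)

/-- The relations of `U_v(sl₂)` are preserved by the anti-automorphism exchanging `e` and `f`. -/
lemma IsSlFamily.mulRight {A : Type*} [Ring A] [Algebra Qv A] {e f k k' : A}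
    (h : IsSlFamily e f k k') :
    IsSlFamily (LinearMap.mulRight Qv f) (LinearMap.mulRight Qv e)
      (LinearMap.mulRight Qv k) (LinearMap.mulRight Qv k') where
  k_k' := by ext x; simp [mul_assoc, h.k'_k]
  k'_k := by ext x; simp [mul_assoc, h.k_k']
  k_e := by
    ext x
    simp only [Module.End.mul_apply, LinearMap.mulRight_apply, LinearMap.smul_apply, mul_assoc,
      h.k_f, mul_smul_comm, smul_smul]
    rw [← zpow_add₀ v_ne_zero]; simp
  k_f := by
    ext x
    simp only [Module.End.mul_apply, LinearMap.mulRight_apply, LinearMap.smul_apply, mul_assoc,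
      h.k_e, mul_smul_comm, smul_smul]
    rw [← zpow_add₀ v_ne_zero]; simp
  e_f := by
    ext x
    simp only [LinearMap.sub_apply, Module.End.mul_apply, LinearMap.mulRight_apply,
      LinearMap.smul_apply, mul_assoc, ← mul_sub, h.e_f, mul_smul_comm]

/-- The product of quantum integers `[a + 1] [k - a]`. -/
def qcoeff (k : ℤ) (a : ℕ) : Qv :=
  ((v ^ ((a : ℤ) + 1) - v ^ (-((a : ℤ) + 1))) * (v ^ (k - a) - v ^ (-(k - a)))) /
    (v - v⁻¹) ^ 2

lemma qcoeff_ne_zero {k : ℤ} {a : ℕ} (h : (a : ℤ) ≠ k) : qcoeff k a ≠ 0 := by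
  refine div_ne_zero (mul_ne_zero ?_ ?_) (pow_ne_zero _ v_sub_inv_ne_zero)
  · exact v_zpow_sub_zpow_neg_ne_zero (by omega)
  · exact v_zpow_sub_zpow_neg_ne_zero (by omega)

lemma qcoeff_zero (k : ℤ) : qcoeff k 0 = (v - v⁻¹)⁻¹ * (v ^ k - v ^ (-k)) := by
  have := v_sub_inv_ne_zero
  simp only [qcoeff, Nat.cast_zero, zero_add, zpow_one, zpow_neg_one, sub_zero]
  generalize v - v⁻¹ = q at *
  field_simp

/-- The identity [a+2][k-a-1] = [a+1][k-a] + [k-2(a+1)]. The last term is the scalar by which ef -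
fe acts on f^(a+1) u when u has weight k. -/
lemma qcoeff_succ (k : ℤ) (a : ℕ) : qcoeff k (a + 1) =
    qcoeff k a + (v - v⁻¹)⁻¹ * (v ^ (k - 2 * ((a : ℤ) + 1)) - v ^ (-(k - 2 * ((a : ℤ) + 1)))) := by
  have hq := v_sub_inv_ne_zero
  have hv := v_ne_zero
  have e : (v - v⁻¹)⁻¹ = (v - v⁻¹) / (v - v⁻¹) ^ 2 := by
    generalize v - v⁻¹ = q at *
    field_simp
  rw [qcoeff, qcoeff, e, div_mul_eq_mul_div, ← add_div]
  congr 1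
  push_cast
  have ha : v ^ (a : ℤ) ≠ 0 := zpow_ne_zero _ hv
  have hk : v ^ k ≠ 0 := zpow_ne_zero _ hv
  have h2 : v ^ (2 * ((a : ℤ) + 1)) = v ^ (a : ℤ) * v ^ (a : ℤ) * v * v := by
    rw [← zpow_add₀ hv, ← zpow_add_one₀ hv, ← zpow_add_one₀ hv]; congr 1; ring
  simp only [zpow_neg, zpow_sub₀ hv, h2]
  simp only [zpow_add₀ hv, zpow_one]
  generalize v ^ (a : ℤ) = x at *
  generalize v ^ k = y at *
  field_simp
  ring

/-! ### Highest weight vectors for quantum sl₂, modulo a stable subspace -/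

section Module

variable {M : Type*} [AddCommGroup M] [Module Qv M] {e f k k' : Module.End Qv M}

lemma IsSlFamily.k'_apply (h : IsSlFamily e f k k') {u : M} {m : ℤ} (hu : k u = v ^ m • u) :
    k' u = v ^ (-m) • u := by
  have h1 : k' (k u) = u := by rw [← Module.End.mul_apply, h.k'_k]; rfl
  rw [hu, map_smul] at h1
  nth_rewrite 2 [← h1]
  rw [smul_smul, ← zpow_add₀ v_ne_zero]
  simp

lemma IsSlFamily.k_e_apply (h : IsSlFamily e f k k') {u : M} {m : ℤ} (hu : k u = v ^ m • u) :
    k (e u) = v ^ (m + 2) • e u := by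
  rw [← Module.End.mul_apply, h.k_e, LinearMap.smul_apply, Module.End.mul_apply, hu, map_smul,
    smul_smul, ← zpow_add₀ v_ne_zero, add_comm]

lemma IsSlFamily.k_f_apply (h : IsSlFamily e f k k') {u : M} {m : ℤ} (hu : k u = v ^ m • u) :
    k (f u) = v ^ (m - 2) • f u := by
  rw [← Module.End.mul_apply, h.k_f, LinearMap.smul_apply, Module.End.mul_apply, hu, map_smul,
    smul_smul, ← zpow_add₀ v_ne_zero, neg_add_eq_sub]

lemma IsSlFamily.k_e_pow_apply (h : IsSlFamily e f k k') {u : M} {m : ℤ}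
    (hu : k u = v ^ m • u) (a : ℕ) : k ((e ^ a) u) = v ^ (m + 2 * a) • (e ^ a) u := by
  induction a with
  | zero => simpa using hu
  | succ a ih =>
    rw [pow_succ', Module.End.mul_apply, h.k_e_apply ih]
    congr 2; push_cast; ring

lemma IsSlFamily.k_f_pow_apply (h : IsSlFamily e f k k') {u : M} {m : ℤ}
    (hu : k u = v ^ m • u) (a : ℕ) : k ((f ^ a) u) = v ^ (m - 2 * a) • (f ^ a) u := by
  induction a with
  | zero => simpa using hu
  | succ a ih =>
    rw [pow_succ', Module.End.mul_apply, h.k_f_apply ih]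
    congr 2; push_cast; ring

/-- The action of `e` on the vectors `f ^ a u`, where `u` is a highest weight vector modulo `N`. -/
lemma IsSlFamily.e_f_pow_sub_mem (h : IsSlFamily e f k k') {N : Submodule Qv M}
    (hf : ∀ x ∈ N, f x ∈ N) {u : M} {m : ℤ} (hu : k u = v ^ m • u) (he : e u ∈ N) (a : ℕ) :
    e ((f ^ (a + 1)) u) - qcoeff m a • (f ^ a) u ∈ N := by
  -- On a vector of weight n the commutator ef - fe is the quantum integer [n].
  have key : ∀ {x : M} {n : ℤ}, k x = v ^ n • x →
      e (f x) = f (e x) + ((v - v⁻¹)⁻¹ * (v ^ n - v ^ (-n))) • x := by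
    intro x n hx
    have := LinearMap.congr_fun h.e_f x
    simp only [LinearMap.sub_apply, Module.End.mul_apply, LinearMap.smul_apply, hx,
      h.k'_apply hx, ← sub_smul, smul_smul] at this
    rw [← this]; abel
  induction a with
  | zero =>
    rw [qcoeff_zero]
    simpa [key hu] using hf _ he
  | succ a ih =>
    have h1 := h.k_f_pow_apply hu (a + 1)
    rw [pow_succ' f (a + 1), Module.End.mul_apply, key h1, qcoeff_succ]
    have h2 := hf _ ih
    rw [map_sub, map_smul, ← Module.End.mul_apply f (f ^ a), ← pow_succ'] at h2
    convert h2 using 1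
    push_cast
    rw [add_smul]; abel

/-- Above n, apply f. Below n, apply e: modulo `N` it sends f^(i+1) u to [i+1][m-i] f^i u, and this
coefficient vanishes only at i = m, so the descent continues down to m + 1. The weight m may be
negative, in which case even u lies in `N`. -/
lemma IsSlFamily.f_pow_mem (h : IsSlFamily e f k k') {N : Submodule Qv M}
    (he' : ∀ x ∈ N, e x ∈ N) (hf : ∀ x ∈ N, f x ∈ N) {u : M} {m : ℤ} (hu : k u = v ^ m • u)
    (he : e u ∈ N) {n : ℕ} (hn : (f ^ n) u ∈ N) {a : ℕ} (ha : m < a) : (f ^ a) u ∈ N := by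
  rcases le_total n a with hna | hna
  · obtain ⟨c, rfl⟩ := Nat.exists_eq_add_of_le' hna
    clear ha hna
    induction c with
    | zero => simpa using hn
    | succ c ih =>
      rw [Nat.succ_add, pow_succ']
      exact hf _ ih
  · induction n, hna using Nat.le_induction with
    | base => exact hn
    | succ n hna ih =>
      apply ih
      have h1 := h.e_f_pow_sub_mem hf hu he n
      have h2 := (N.sub_mem_iff_right (he' _ hn)).1 h1
      exact (N.smul_mem_iff (qcoeff_ne_zero (by omega))).1 h2

lemma IsSlFamily.e_f_pow (h : IsSlFamily e f k k') {u : M} {m : ℤ} (hu : k u = v ^ m • u)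
    (he : e u = 0) (a : ℕ) : e ((f ^ (a + 1)) u) = qcoeff m a • (f ^ a) u := by
  have := h.e_f_pow_sub_mem (N := ⊥) (by simp) hu (by simpa using he) a
  simpa [sub_eq_zero] using this

/-- For a highest weight vector `u` of weight `m`, `e ^ a f ^ a u` is a nonzero multiple of `u`
when `a ≤ m`. -/
lemma IsSlFamily.exists_e_pow_f_pow (h : IsSlFamily e f k k') {u : M} {m : ℤ}
    (hu : k u = v ^ m • u) (he : e u = 0) {a : ℕ} (ha : (a : ℤ) ≤ m) :
    ∃ c : Qv, c ≠ 0 ∧ (e ^ a) ((f ^ a) u) = c • u := by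
  induction a with
  | zero => exact ⟨1, one_ne_zero, by simp⟩
  | succ a ih =>
    obtain ⟨c, hc, hcu⟩ := ih (by push_cast at ha; omega)
    refine ⟨qcoeff m a * c, mul_ne_zero (qcoeff_ne_zero (by push_cast at ha; omega)) hc, ?_⟩
    rw [pow_succ e, Module.End.mul_apply, h.e_f_pow hu he, map_smul, hcu, smul_smul]

end Module

/-! ### The presented algebra -/

section Presented

variable (d : ℕ)

lemma sl_isSlFamily : IsSlFamily (sl d .e) (sl d .f) (sl d .K) (sl d .Kinv) := by
  have h1 : sl d .K * sl d .Kinv = 1 := by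
    simpa [sl] using RingQuot.mkAlgHom_rel Qv (SlRel.K_Kinv (d := d))
  have h2 : sl d .Kinv * sl d .K = 1 := by
    simpa [sl] using RingQuot.mkAlgHom_rel Qv (SlRel.Kinv_K (d := d))
  refine ⟨h1, h2, mul_eq_of_conj h2 ?_, mul_eq_of_conj h2 ?_, ?_⟩
  · have := RingQuot.mkAlgHom_rel Qv (SlRel.K_e (d := d))
    simp only [map_mul, map_smul] at this
    exact_mod_cast this
  · have := RingQuot.mkAlgHom_rel Qv (SlRel.K_f (d := d))
    simp only [map_mul, map_smul] at this
    exact this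
  · simpa [sl] using RingQuot.mkAlgHom_rel Qv (SlRel.e_f (d := d))

/-- The `j`-th eigenvalue `v ^ (d - 2j)` of `K`. -/
def node (j : ℕ) : Qv := v ^ ((d : ℤ) - 2 * (j : ℤ))

lemma node_injective : Function.Injective (node d) := by
  intro i j h
  have := v_zpow_injective h
  omega

lemma aeval_nodal {A : Type*} [Ring A] [Algebra Qv A] (x : A) :
    Polynomial.aeval x (Lagrange.nodal (Finset.range (d + 1)) (node d)) =
      ((List.range (d + 1)).map fun i : ℕ =>
        x - algebraMap Qv A (v ^ ((d : ℤ) - 2 * (i : ℤ)))).prod := by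
  -- The defining relation is an ordered product over a list; for polynomials it is the nodal
  -- polynomial by unfolding.
  have : Lagrange.nodal (Finset.range (d + 1)) (node d) =
      ((List.range (d + 1)).map fun i : ℕ =>
        Polynomial.X - Polynomial.C (v ^ ((d : ℤ) - 2 * (i : ℤ)))).prod := rfl
  rw [this, map_list_prod, List.map_map]
  congr 1
  apply List.map_congr_left
  intro i _
  simp only [Function.comp_apply, map_sub, Polynomial.aeval_X, Polynomial.aeval_C]

lemma aeval_K_nodal :
    Polynomial.aeval (sl d .K) (Lagrange.nodal (Finset.range (d + 1)) (node d)) = 0 := by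
  have := RingQuot.mkAlgHom_rel Qv (SlRel.prod_K (d := d))
  rw [← aeval_nodal, ← Polynomial.aeval_algHom_apply, map_zero] at this
  exact this

lemma adjoin_range_sl : Algebra.adjoin Qv (Set.range (sl d)) = ⊤ := by
  have h : Set.range (sl d) =
      RingQuot.mkAlgHom Qv (SlRel d) '' Set.range (FreeAlgebra.ι Qv) := by
    rw [← Set.range_comp]; rfl
  rw [h, ← AlgHom.map_adjoin, FreeAlgebra.adjoin_range_ι, Algebra.map_top]
  exact (AlgHom.range_eq_top _).2 (RingQuot.mkAlgHom_surjective _ _)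

variable {d}

/-- A subspace of a representation which is stable under `e`, `f` and `K` is stable under the
presented algebra. -/
lemma stable_of_generators {M : Type*} [AddCommGroup M] [Module Qv M]
    (π : Presented d →ₐ[Qv] Module.End Qv M) {N : Submodule Qv M}
    (h : ∀ g, ∀ x ∈ N, π (sl d g) x ∈ N) (p : Presented d) : ∀ x ∈ N, π p x ∈ N := by
  have hp : p ∈ Algebra.adjoin Qv (Set.range (sl d)) := by rw [adjoin_range_sl]; trivial
  induction hp using Algebra.adjoin_induction with
  | mem p hp =>
    obtain ⟨g, rfl⟩ := hp
    exact h g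
  | algebraMap r =>
    intro x hx
    rw [AlgHom.commutes, Module.algebraMap_end_apply]
    exact N.smul_mem _ hx
  | add p q _ _ hp hq =>
    intro x hx
    rw [map_add]
    exact N.add_mem (hp x hx) (hq x hx)
  | mul p q _ _ hp hq =>
    intro x hx
    rw [map_mul]
    exact hp _ (hq x hx)

lemma mul_left_stable {N : Submodule Qv (Presented d)}
    (h : ∀ g, ∀ x ∈ N, sl d g * x ∈ N) (p x : Presented d) (hx : x ∈ N) : p * x ∈ N :=
  stable_of_generators (Algebra.lmul Qv (Presented d)) h p x hx

/-- Right multiplication reverses products and so is not a representation of the presented algebra;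
hence a separate induction. -/
lemma mul_right_stable {N : Submodule Qv (Presented d)}
    (h : ∀ g, ∀ x ∈ N, x * sl d g ∈ N) (p : Presented d) : ∀ x ∈ N, x * p ∈ N := by
  have hp : p ∈ Algebra.adjoin Qv (Set.range (sl d)) := by rw [adjoin_range_sl]; trivial
  induction hp using Algebra.adjoin_induction with
  | mem p hp =>
    obtain ⟨g, rfl⟩ := hp
    exact h g
  | algebraMap r =>
    intro x hx
    rw [← Algebra.commutes, ← Algebra.smul_def]
    exact N.smul_mem _ hx
  | add p q _ _ hp hq =>
    intro x hx
    rw [mul_add]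
    exact N.add_mem (hp x hx) (hq x hx)
  | mul p q _ _ hp hq =>
    intro x hx
    rw [← mul_assoc]
    exact hq _ (hp x hx)

/-! ### Weight idempotents -/

variable (d) in
/-- The idempotent which projects onto the `K`-eigenspace with eigenvalue `v ^ (d - 2j)`. -/
def idem (j : ℕ) : Presented d :=
  Polynomial.aeval (sl d .K) (Lagrange.basis (Finset.range (d + 1)) (node d) j)

variable (d) in
lemma sum_idem : ∑ j ∈ Finset.range (d + 1), idem d j = 1 := by
  have h := Lagrange.sum_basis (s := Finset.range (d + 1)) (v := node d)
    ((node_injective d).injOn) ⟨0, by simp⟩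
  have := congrArg (Polynomial.aeval (sl d .K)) h
  simpa [idem] using this

lemma idem_K_comm (j : ℕ) : idem d j * sl d .K = sl d .K * idem d j := by
  have h := congrArg (Polynomial.aeval (sl d .K)) (mul_comm
    (Lagrange.basis (Finset.range (d + 1)) (node d) j) Polynomial.X)
  simpa [idem] using h

/-- Multiplying the j-th Lagrange basis polynomial by X minus its node gives a scalar multiple of
the nodal polynomial, which vanishes at K. -/
lemma K_idem {j : ℕ} (hj : j ≤ d) :
    sl d .K * idem d j = v ^ ((d : ℤ) - 2 * (j : ℤ)) • idem d j := by
  have hj' : j ∈ Finset.range (d + 1) := by simpa [Nat.lt_succ_iff] using hj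
  have h0 : (Polynomial.X - Polynomial.C (node d j)) *
      Lagrange.basis (Finset.range (d + 1)) (node d) j =
      Polynomial.C (Lagrange.nodalWeight (Finset.range (d + 1)) (node d) j) *
        Lagrange.nodal (Finset.range (d + 1)) (node d) := by
    rw [Lagrange.basis_eq_prod_sub_inv_mul_nodal_div hj', mul_left_comm,
      ← Lagrange.nodal_erase_eq_nodal_div hj', ← Lagrange.nodal_eq_mul_nodal_erase hj']
  have h := congrArg (Polynomial.aeval (sl d .K)) h0
  rw [map_mul, map_mul, aeval_K_nodal, mul_zero, map_sub, Polynomial.aeval_X, Polynomial.aeval_C,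
    sub_mul, ← Algebra.smul_def] at h
  exact sub_eq_zero.1 h

/-- Evaluate 1_i K x in two ways. Letting m be any integer covers weights that are not eigenvalues
of K; these occur only for x = 0, because the 1_i sum to 1. -/
lemma idem_mul_eq_zero {i : ℕ} (hi : i ≤ d) {m : ℤ} (hm : m ≠ i) {x : Presented d}
    (hx : sl d .K * x = v ^ ((d : ℤ) - 2 * m) • x) : idem d i * x = 0 := by
  have h1 : v ^ ((d : ℤ) - 2 * (i : ℤ)) • (idem d i * x) =
      v ^ ((d : ℤ) - 2 * m) • (idem d i * x) := by
    rw [← smul_mul_assoc, ← K_idem hi, ← idem_K_comm, mul_assoc, hx, mul_smul_comm]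
  exact eq_zero_of_v_zpow_smul_eq (by omega) h1

lemma mul_idem_eq_zero {i : ℕ} (hi : i ≤ d) {m : ℤ} (hm : m ≠ i) {x : Presented d}
    (hx : x * sl d .K = v ^ ((d : ℤ) - 2 * m) • x) : x * idem d i = 0 := by
  have h1 : v ^ ((d : ℤ) - 2 * (i : ℤ)) • (x * idem d i) =
      v ^ ((d : ℤ) - 2 * m) • (x * idem d i) := by
    rw [← mul_smul_comm, ← K_idem hi, ← mul_assoc, hx, smul_mul_assoc]
  exact eq_zero_of_v_zpow_smul_eq (by omega) h1

lemma idem_mul_eq_self {i : ℕ} (hi : i ≤ d) {x : Presented d}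
    (hx : sl d .K * x = v ^ ((d : ℤ) - 2 * (i : ℤ)) • x) : idem d i * x = x := by
  conv_rhs => rw [← one_mul x, ← sum_idem d, Finset.sum_mul]
  rw [Finset.sum_eq_single i]
  · intro l hl hli
    exact idem_mul_eq_zero (by simpa [Nat.lt_succ_iff] using hl) (by omega) hx
  · intro h; simp [hi] at h

lemma mul_idem_eq_self {i : ℕ} (hi : i ≤ d) {x : Presented d}
    (hx : x * sl d .K = v ^ ((d : ℤ) - 2 * (i : ℤ)) • x) : x * idem d i = x := by
  conv_rhs => rw [← mul_one x, ← sum_idem d, Finset.mul_sum]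
  rw [Finset.sum_eq_single i]
  · intro l hl hli
    exact mul_idem_eq_zero (by simpa [Nat.lt_succ_iff] using hl) (by omega) hx
  · intro h; simp [hi] at h

lemma eq_zero_of_K_mul {m : ℤ} (hm : m < 0 ∨ d < m) {x : Presented d}
    (hx : sl d .K * x = v ^ ((d : ℤ) - 2 * m) • x) : x = 0 := by
  rw [← one_mul x, ← sum_idem d, Finset.sum_mul]
  refine Finset.sum_eq_zero fun l hl => ?_
  have : l ≤ d := by simpa [Nat.lt_succ_iff] using hl
  exact idem_mul_eq_zero this (by omega) hx

lemma eq_zero_of_mul_K {m : ℤ} (hm : m < 0 ∨ d < m) {x : Presented d}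
    (hx : x * sl d .K = v ^ ((d : ℤ) - 2 * m) • x) : x = 0 := by
  rw [← mul_one x, ← sum_idem d, Finset.mul_sum]
  refine Finset.sum_eq_zero fun l hl => ?_
  have : l ≤ d := by simpa [Nat.lt_succ_iff] using hl
  exact mul_idem_eq_zero this (by omega) hx

/-! ### The filtration by two-sided ideals -/

variable (d) in
/-- The two-sided ideal of the presented algebra generated by the idempotents `idem d i` with
`i < j`, as a subspace. -/
def idemIdeal (j : ℕ) : Submodule Qv (Presented d) :=
  Submodule.span Qv {z | ∃ i < j, ∃ x y, z = x * idem d i * y}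

lemma mul_idem_mul_mem {i j : ℕ} (h : i < j) (x y : Presented d) :
    x * idem d i * y ∈ idemIdeal d j :=
  Submodule.subset_span ⟨i, h, x, y, rfl⟩

lemma mul_mem_idemIdeal {j : ℕ} (p : Presented d) {x : Presented d} (hx : x ∈ idemIdeal d j) :
    p * x ∈ idemIdeal d j := by
  refine (Submodule.span_le (p := (idemIdeal d j).comap (LinearMap.mulLeft Qv p))).2 ?_ hx
  rintro _ ⟨i, hi, x, y, rfl⟩
  simpa [mul_assoc] using mul_idem_mul_mem hi (p * x) y

lemma mem_mul_idemIdeal {j : ℕ} (p : Presented d) {x : Presented d} (hx : x ∈ idemIdeal d j) :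
    x * p ∈ idemIdeal d j := by
  refine (Submodule.span_le (p := (idemIdeal d j).comap (LinearMap.mulRight Qv p))).2 ?_ hx
  rintro _ ⟨i, hi, x, y, rfl⟩
  simpa [mul_assoc] using mul_idem_mul_mem hi x (y * p)

variable (d) in
lemma idemIdeal_zero : idemIdeal d 0 = ⊥ := by simp [idemIdeal]

variable (d) in
lemma mem_idemIdeal_succ_self (x : Presented d) : x ∈ idemIdeal d (d + 1) := by
  rw [← mul_one x, ← sum_idem d, Finset.mul_sum]
  refine Submodule.sum_mem _ fun i hi => ?_
  simpa using mul_idem_mul_mem (Finset.mem_range.1 hi) x 1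

/-- Since e moves the weight index from j to j - 1, the product equals 1_(j-1) e 1_j, or is zero if
j = 0, where the index -1 is not available. -/
lemma e_idem_mem {j : ℕ} (hj : j ≤ d) : sl d .e * idem d j ∈ idemIdeal d j := by
  have h := (sl_isSlFamily d).mulLeft.k_e_apply (u := idem d j) (K_idem hj)
  change sl d .K * (sl d .e * idem d j) = _ • (sl d .e * idem d j) at h
  cases j with
  | zero =>
    have : sl d .e * idem d 0 = 0 :=
      eq_zero_of_K_mul (m := -1) (by omega) (by rw [h]; congr 2)
    rw [this]; exact Submodule.zero_mem _
  | succ j =>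
    have : idem d j * (sl d .e * idem d (j + 1)) = sl d .e * idem d (j + 1) :=
      idem_mul_eq_self (by omega) (by rw [h]; congr 2; push_cast; ring)
    rw [← this, ← one_mul (idem d j)]
    exact mul_idem_mul_mem (Nat.lt_succ_self j) _ _

/-- Mirror image of `e_idem_mem`: under right multiplication it is f that raises weights. -/
lemma idem_f_mem {j : ℕ} (hj : j ≤ d) : idem d j * sl d .f ∈ idemIdeal d j := by
  have h := (sl_isSlFamily d).mulRight.k_e_apply (u := idem d j)
    ((idem_K_comm j).trans (K_idem hj))
  change (idem d j * sl d .f) * sl d .K = _ • (idem d j * sl d .f) at h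
  cases j with
  | zero =>
    have : idem d 0 * sl d .f = 0 :=
      eq_zero_of_mul_K (m := -1) (by omega) (by rw [h]; congr 2)
    rw [this]; exact Submodule.zero_mem _
  | succ j =>
    have : (idem d (j + 1) * sl d .f) * idem d j = idem d (j + 1) * sl d .f :=
      mul_idem_eq_self (by omega) (by rw [h]; congr 2; push_cast; ring)
    rw [← this, ← mul_one (_ * idem d j)]
    exact mul_idem_mul_mem (Nat.lt_succ_self j) _ _

lemma K_f_pow_idem {j : ℕ} (hj : j ≤ d) (a : ℕ) : sl d .K * (sl d .f ^ a * idem d j) =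
    v ^ ((d : ℤ) - 2 * ((j + a : ℕ) : ℤ)) • (sl d .f ^ a * idem d j) := by
  have h := (sl_isSlFamily d).mulLeft.k_f_pow_apply (u := idem d j) (K_idem hj) a
  rw [LinearMap.pow_mulLeft] at h
  refine h.trans ?_
  congr 2; push_cast; ring

lemma idem_e_pow_K {j : ℕ} (hj : j ≤ d) (b : ℕ) : (idem d j * sl d .e ^ b) * sl d .K =
    v ^ ((d : ℤ) - 2 * ((j + b : ℕ) : ℤ)) • (idem d j * sl d .e ^ b) := by
  have h := (sl_isSlFamily d).mulRight.k_f_pow_apply (u := idem d j)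
    ((idem_K_comm j).trans (K_idem hj)) b
  rw [LinearMap.pow_mulRight] at h
  refine h.trans ?_
  congr 2; push_cast; ring

/-- The power f^(d+1) takes 1_j below the lowest weight, hence to zero; `IsSlFamily.f_pow_mem` then
improves the exponent to d - 2j + 1 modulo the ideal. If 2j > d, already a = 0 is allowed and 1_j
lies in the ideal. -/
lemma f_pow_idem_mem {j : ℕ} (hj : j ≤ d) {a : ℕ} (ha : d < a + 2 * j) :
    sl d .f ^ a * idem d j ∈ idemIdeal d j := by
  have H := (sl_isSlFamily d).mulLeft
  have h0 : sl d .f ^ (d + 1) * idem d j = 0 :=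
    eq_zero_of_K_mul (by omega) (K_f_pow_idem hj (d + 1))
  have h := H.f_pow_mem (N := idemIdeal d j) (fun x hx => mul_mem_idemIdeal _ hx)
    (fun x hx => mul_mem_idemIdeal _ hx) (u := idem d j) (K_idem hj) (e_idem_mem hj) (n := d + 1) (a := a)
    (by rw [LinearMap.pow_mulLeft, LinearMap.mulLeft_apply, h0]; exact zero_mem _)
    (by omega)
  rw [LinearMap.pow_mulLeft] at h
  exact h

lemma idem_e_pow_mem {j : ℕ} (hj : j ≤ d) {b : ℕ} (hb : d < b + 2 * j) :
    idem d j * sl d .e ^ b ∈ idemIdeal d j := by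
  have h0 : idem d j * sl d .e ^ (d + 1) = 0 :=
    eq_zero_of_mul_K (by omega) (idem_e_pow_K hj (d + 1))
  have h := (sl_isSlFamily d).mulRight.f_pow_mem (N := idemIdeal d j)
    (fun x hx => mem_mul_idemIdeal _ hx) (fun x hx => mem_mul_idemIdeal _ hx) (u := idem d j)
    ((idem_K_comm j).trans (K_idem hj)) (idem_f_mem hj) (n := d + 1) (a := b)
    (by rw [LinearMap.pow_mulRight, LinearMap.mulRight_apply, h0]; exact zero_mem _)
    (by omega)
  rwa [LinearMap.pow_mulRight] at h

/-- The right-hand side contains 1_j or absorbs it, and is stable under left multiplication by the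
generators. The truncated subtraction leaves no vectors f^a 1_j when 2j > d, as it should. -/
lemma mul_idem_mem_sup {j : ℕ} (hj : j ≤ d) (p : Presented d) :
    p * idem d j ∈ idemIdeal d j ⊔
      Submodule.span Qv (Set.range fun a : Fin (d + 1 - 2 * j) => sl d .f ^ (a : ℕ) * idem d j) := by
  set N := idemIdeal d j ⊔ Submodule.span Qv
    (Set.range fun a : Fin (d + 1 - 2 * j) => sl d .f ^ (a : ℕ) * idem d j) with hN
  have H := (sl_isSlFamily d).mulLeft
  have hleft : idemIdeal d j ≤ N := le_sup_left
  have mem : ∀ a : ℕ, sl d .f ^ a * idem d j ∈ N := by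
    intro a
    by_cases ha : a < d + 1 - 2 * j
    · exact (le_sup_right : _ ≤ N) (Submodule.subset_span ⟨⟨a, ha⟩, rfl⟩)
    · exact hleft (f_pow_idem_mem hj (by omega))
  refine mul_left_stable (fun g x hx => ?_) p _ (by simpa using mem 0)
  refine (sup_le ?_ ?_ : N ≤ N.comap (LinearMap.mulLeft Qv (sl d g))) hx
  · exact fun x hx => hleft (mul_mem_idemIdeal _ hx)
  rw [Submodule.span_le]
  rintro _ ⟨a, rfl⟩
  change sl d g * (sl d .f ^ (a : ℕ) * idem d j) ∈ N
  have hK := K_f_pow_idem hj a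
  cases g with
  | e =>
    obtain ⟨a, ha⟩ := a
    cases a with
    | zero => simpa using hleft (e_idem_mem hj)
    | succ a =>
      have h := H.e_f_pow_sub_mem (N := idemIdeal d j) (fun x hx => mul_mem_idemIdeal _ hx)
        (u := idem d j) (K_idem hj) (e_idem_mem hj) a
      rw [LinearMap.pow_mulLeft, LinearMap.pow_mulLeft] at h
      exact (N.sub_mem_iff_left (N.smul_mem _ (mem a))).1 (hleft h)
  | f =>
    rw [← mul_assoc, ← pow_succ']
    exact mem _
  | K => rw [hK]; exact N.smul_mem _ (mem a)
  | Kinv =>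
    have h := H.k'_apply hK
    change sl d .Kinv * (sl d .f ^ (a : ℕ) * idem d j) = _ at h
    rw [h]; exact N.smul_mem _ (mem a)

lemma idem_mul_mem_sup {j : ℕ} (hj : j ≤ d) (p : Presented d) :
    idem d j * p ∈ idemIdeal d j ⊔
      Submodule.span Qv (Set.range fun b : Fin (d + 1 - 2 * j) => idem d j * sl d .e ^ (b : ℕ)) := by
  set N := idemIdeal d j ⊔ Submodule.span Qv
    (Set.range fun b : Fin (d + 1 - 2 * j) => idem d j * sl d .e ^ (b : ℕ)) with hN
  have H := (sl_isSlFamily d).mulRight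
  have hleft : idemIdeal d j ≤ N := le_sup_left
  have mem : ∀ b : ℕ, idem d j * sl d .e ^ b ∈ N := by
    intro b
    by_cases hb : b < d + 1 - 2 * j
    · exact (le_sup_right : _ ≤ N) (Submodule.subset_span ⟨⟨b, hb⟩, rfl⟩)
    · exact hleft (idem_e_pow_mem hj (by omega))
  refine mul_right_stable (fun g x hx => ?_) p _ (by simpa using mem 0)
  refine (sup_le ?_ ?_ : N ≤ N.comap (LinearMap.mulRight Qv (sl d g))) hx
  · exact fun x hx => hleft (mem_mul_idemIdeal _ hx)
  rw [Submodule.span_le]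
  rintro _ ⟨b, rfl⟩
  change (idem d j * sl d .e ^ (b : ℕ)) * sl d g ∈ N
  have hK := idem_e_pow_K hj b
  cases g with
  | f =>
    obtain ⟨b, hb⟩ := b
    cases b with
    | zero => simpa using hleft (idem_f_mem hj)
    | succ b =>
      have h := H.e_f_pow_sub_mem (N := idemIdeal d j) (fun x hx => mem_mul_idemIdeal _ hx)
        (u := idem d j) ((idem_K_comm j).trans (K_idem hj)) (idem_f_mem hj) b
      rw [LinearMap.pow_mulRight, LinearMap.pow_mulRight] at h
      exact (N.sub_mem_iff_left (N.smul_mem _ (mem b))).1 (hleft h)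
  | e =>
    rw [mul_assoc, ← pow_succ]
    exact mem _
  | K => rw [hK]; exact N.smul_mem _ (mem b)
  | Kinv =>
    have h := H.k'_apply hK
    change (idem d j * sl d .e ^ (b : ℕ)) * sl d .Kinv = _ at h
    rw [h]; exact N.smul_mem _ (mem b)

/-- The layers of the filtration by the ideals `idemIdeal d j` are spanned by the elements
`f ^ a * idem d j * e ^ b`. -/
lemma idemIdeal_succ_le {j : ℕ} (hj : j ≤ d) : idemIdeal d (j + 1) ≤ idemIdeal d j ⊔
    Submodule.span Qv (Set.range fun p : Fin (d + 1 - 2 * j) × Fin (d + 1 - 2 * j) =>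
      sl d .f ^ (p.1 : ℕ) * idem d j * sl d .e ^ (p.2 : ℕ)) := by
  set N := idemIdeal d j ⊔ Submodule.span Qv
    (Set.range fun p : Fin (d + 1 - 2 * j) × Fin (d + 1 - 2 * j) =>
      sl d .f ^ (p.1 : ℕ) * idem d j * sl d .e ^ (p.2 : ℕ)) with hN
  have hleft : idemIdeal d j ≤ N := le_sup_left
  refine Submodule.span_le.2 ?_
  rintro _ ⟨i, hi, x, y, rfl⟩
  rcases Nat.lt_succ_iff_lt_or_eq.1 hi with hi | rfl
  · exact hleft (mul_idem_mul_mem hi x y)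
  have h1 : ∀ (a : Fin (d + 1 - 2 * i)), sl d .f ^ (a : ℕ) * idem d i * y ∈ N := by
    intro a
    rw [mul_assoc]
    refine (sup_le ?_ ?_ : _ ≤ N.comap (LinearMap.mulLeft Qv (sl d .f ^ (a : ℕ))))
      (idem_mul_mem_sup hj y)
    · exact fun x hx => hleft (mul_mem_idemIdeal _ hx)
    rw [Submodule.span_le]
    rintro _ ⟨b, rfl⟩
    refine (le_sup_right : _ ≤ N) (Submodule.subset_span ⟨(a, b), ?_⟩)
    simp [mul_assoc]
  refine (sup_le ?_ ?_ : _ ≤ N.comap (LinearMap.mulRight Qv y)) (mul_idem_mem_sup hj x)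
  · exact fun x hx => hleft (mem_mul_idemIdeal _ hx)
  rw [Submodule.span_le]
  rintro _ ⟨a, rfl⟩
  exact h1 a

end Presented

/-! ### Weight vectors in tensor powers -/

lemma tensorRep_e {V W : Type} [AddCommGroup V] [Module Qv V] [AddCommGroup W] [Module Qv W]
    (φ : U →ₐ[Qv] Module.End Qv V) (ψ : U →ₐ[Qv] Module.End Qv W) (x : V) (y : W) :
    tensorRep φ ψ (gl .e) (x ⊗ₜ y) =
      φ (gl .e) x ⊗ₜ y + φ (gl .K1) (φ (gl .K2inv) x) ⊗ₜ ψ (gl .e) y := by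
  simp [tensorRep, comul, comulGen, Module.endTensorEndAlgHom_apply]

lemma tensorRep_K1 {V W : Type} [AddCommGroup V] [Module Qv V] [AddCommGroup W] [Module Qv W]
    (φ : U →ₐ[Qv] Module.End Qv V) (ψ : U →ₐ[Qv] Module.End Qv W) (x : V) (y : W) :
    tensorRep φ ψ (gl .K1) (x ⊗ₜ y) = φ (gl .K1) x ⊗ₜ ψ (gl .K1) y := by
  simp [tensorRep, comul, comulGen, Module.endTensorEndAlgHom_apply]

lemma tensorRep_K2 {V W : Type} [AddCommGroup V] [Module Qv V] [AddCommGroup W] [Module Qv W]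
    (φ : U →ₐ[Qv] Module.End Qv V) (ψ : U →ₐ[Qv] Module.End Qv W) (x : V) (y : W) :
    tensorRep φ ψ (gl .K2) (x ⊗ₜ y) = φ (gl .K2) x ⊗ₜ ψ (gl .K2) y := by
  simp [tensorRep, comul, comulGen, Module.endTensorEndAlgHom_apply]

/-- The tensor product of a vector of `E^{⊗ d}` with a vector of `E`, in `E^{⊗ (d + 1)}`. -/
def snoc {d : ℕ} (x : ⨂[Qv]^d E) (y : E) : ⨂[Qv]^(d + 1) E := tensorPowerSucc d (x ⊗ₜ y)

lemma smul_snoc_smul {d : ℕ} (c c' : Qv) (x : ⨂[Qv]^d E) (y : E) :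
    snoc (c • x) (c' • y) = (c * c') • snoc x y := by
  simp only [snoc, TensorProduct.smul_tmul_smul, map_smul]

lemma smul_snoc {d : ℕ} (c : Qv) (x : ⨂[Qv]^d E) (y : E) : snoc (c • x) y = c • snoc x y := by
  simpa using smul_snoc_smul c 1 x y

lemma zero_snoc {d : ℕ} (y : E) : snoc (0 : ⨂[Qv]^d E) y = 0 := by
  simp [snoc]

lemma snoc_zero {d : ℕ} (x : ⨂[Qv]^d E) : snoc x 0 = 0 := by
  simp [snoc]

lemma rhoD_succ_apply (d : ℕ) (u : U) (t : (⨂[Qv]^d E) ⊗[Qv] E) :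
    rhoD (d + 1) u (tensorPowerSucc d t) =
      tensorPowerSucc d (tensorRep (rhoD d) rho u t) := by
  simp [rhoD, LinearEquiv.conjAlgEquiv_apply]

lemma rhoD_e_snoc {d : ℕ} (x : ⨂[Qv]^d E) (y : E) : rhoD (d + 1) (gl .e) (snoc x y) =
    snoc (rhoD d (gl .e) x) y + snoc (rhoD d (gl .K1) (rhoD d (gl .K2inv) x)) (rho (gl .e) y) := by
  simp [snoc, rhoD_succ_apply, tensorRep_e]

lemma rhoD_K1_snoc {d : ℕ} (x : ⨂[Qv]^d E) (y : E) : rhoD (d + 1) (gl .K1) (snoc x y) =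
    snoc (rhoD d (gl .K1) x) (rho (gl .K1) y) := by
  simp [snoc, rhoD_succ_apply, tensorRep_K1]

lemma rhoD_K2_snoc {d : ℕ} (x : ⨂[Qv]^d E) (y : E) : rhoD (d + 1) (gl .K2) (snoc x y) =
    snoc (rhoD d (gl .K2) x) (rho (gl .K2) y) := by
  simp [snoc, rhoD_succ_apply, tensorRep_K2]

/-- The vectors of weight `(a, b)` in a representation of `U_v(gl₂)`. -/
structure IsWeight {V : Type*} [AddCommGroup V] [Module Qv V] (φ : U →ₐ[Qv] Module.End Qv V)
    (a b : ℕ) (x : V) : Prop where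
  K1 : φ (gl .K1) x = v ^ (a : ℤ) • x
  K2 : φ (gl .K2) x = v ^ (b : ℤ) • x

lemma isWeight_rho_zero : IsWeight rho 1 0 (Pi.single 0 1) := by
  constructor <;> ext i <;> fin_cases i <;> simp [rho, vecGen]

lemma isWeight_rho_one : IsWeight rho 0 1 (Pi.single 1 1) := by
  constructor <;> ext i <;> fin_cases i <;> simp [rho, vecGen]

lemma rho_e_zero : rho (gl .e) (Pi.single 0 1) = 0 := by
  ext i; fin_cases i <;> simp [rho, vecGen]

lemma rho_e_one : rho (gl .e) (Pi.single 1 1) = Pi.single 0 1 := by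
  ext i; fin_cases i <;> simp [rho, vecGen]

section IsWeight

variable {V : Type*} [AddCommGroup V] [Module Qv V] {φ : U →ₐ[Qv] Module.End Qv V} {a b : ℕ}
  {x : V}

lemma apply_of_inverse {g h : U} (hgh : h * g = 1) {m : ℤ} (hx : φ g x = v ^ m • x) :
    φ h x = v ^ (-m) • x := by
  have h1 : φ h (φ g x) = x := by rw [← Module.End.mul_apply, ← map_mul, hgh, map_one]; rfl
  rw [hx, map_smul] at h1
  nth_rewrite 2 [← h1]
  rw [smul_smul, ← zpow_add₀ v_ne_zero]
  simp

lemma IsWeight.K1inv (h : IsWeight φ a b x) : φ (gl .K1inv) x = v ^ (-(a : ℤ)) • x :=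
  apply_of_inverse gl_isGlFamily.K1inv_K1 h.K1

lemma IsWeight.K2inv (h : IsWeight φ a b x) : φ (gl .K2inv) x = v ^ (-(b : ℤ)) • x :=
  apply_of_inverse gl_isGlFamily.K2inv_K2 h.K2

lemma IsWeight.K (h : IsWeight φ a b x) :
    φ (gl .K1 * gl .K2inv) x = v ^ ((a : ℤ) - b) • x := by
  rw [map_mul, Module.End.mul_apply, h.K2inv, map_smul, h.K1, smul_smul,
    ← zpow_add₀ v_ne_zero, neg_add_eq_sub]

end IsWeight

lemma IsWeight.snoc {d a b a' b' : ℕ} {x : ⨂[Qv]^d E} {y : E} (hx : IsWeight (rhoD d) a b x)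
    (hy : IsWeight rho a' b' y) : IsWeight (rhoD (d + 1)) (a + a') (b + b') (snoc x y) where
  K1 := by
    rw [rhoD_K1_snoc, hx.K1, hy.K1, Nat.cast_add, zpow_add₀ v_ne_zero, smul_snoc_smul]
  K2 := by
    rw [rhoD_K2_snoc, hx.K2, hy.K2, Nat.cast_add, zpow_add₀ v_ne_zero, smul_snoc_smul]

/-- The tensor power `E^{⊗ d}` is spanned by weight vectors. -/
lemma span_isWeight (d : ℕ) :
    Submodule.span Qv {x | ∃ a b, a + b = d ∧ IsWeight (rhoD d) a b x} = ⊤ := by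
  induction d with
  | zero =>
    -- The counit makes both Kᵢ act as 1, so every vector has weight (0, 0).
    refine Submodule.eq_top_iff'.2 fun x => Submodule.subset_span ⟨0, 0, rfl, ?_, ?_⟩ <;>
      simp [rhoD, counit, counitGen]
  | succ d ih =>
    set S := Submodule.span Qv {x | ∃ a b, a + b = d + 1 ∧ IsWeight (rhoD (d + 1)) a b x}
    have hE : ∀ y : E, y = y 0 • Pi.single 0 1 + y 1 • Pi.single 1 1 := by
      intro y; ext i; fin_cases i <;> simp
    have h1 : ∀ (x : ⨂[Qv]^d E) (y : E), tensorPowerSucc d (x ⊗ₜ y) ∈ S := by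
      intro x y
      have hx : x ∈ Submodule.span Qv {x | ∃ a b, a + b = d ∧ IsWeight (rhoD d) a b x} := by
        rw [ih]; trivial
      induction hx using Submodule.span_induction with
      | mem x hx =>
        obtain ⟨a, b, hab, hx⟩ := hx
        rw [hE y, TensorProduct.tmul_add, map_add, TensorProduct.tmul_smul,
          TensorProduct.tmul_smul, map_smul, map_smul]
        refine S.add_mem (S.smul_mem _ (Submodule.subset_span ?_))
          (S.smul_mem _ (Submodule.subset_span ?_))
        · exact ⟨_, _, by omega, hx.snoc isWeight_rho_zero⟩
        · exact ⟨_, _, by omega, hx.snoc isWeight_rho_one⟩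
      | zero => simp
      | add x x' _ _ hx hx' =>
        rw [TensorProduct.add_tmul, map_add]
        exact S.add_mem hx hx'
      | smul c x _ hx =>
        rw [← TensorProduct.smul_tmul', map_smul]
        exact S.smul_mem _ hx
    refine Submodule.eq_top_iff'.2 fun z => ?_
    obtain ⟨t, rfl⟩ := (tensorPowerSucc d).surjective z
    induction t using TensorProduct.induction_on with
    | zero => simp
    | tmul x y => exact h1 x y
    | add t t' ht ht' =>
      rw [map_add]
      exact S.add_mem ht ht'

/-- Contraction of the last tensor factor with a coordinate of `E`. -/
def contract {d : ℕ} (i : Fin 2) : (⨂[Qv]^(d + 1) E) →ₗ[Qv] ⨂[Qv]^d E :=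
  (TensorProduct.rid Qv _).toLinearMap ∘ₗ
    (LinearMap.lTensor _ (LinearMap.proj i)) ∘ₗ (tensorPowerSucc d).symm.toLinearMap

lemma contract_snoc {d : ℕ} (i : Fin 2) (x : ⨂[Qv]^d E) (y : E) :
    contract i (snoc x y) = y i • x := by
  simp [contract, snoc]

/-- There is a highest weight vector of weight `(d - j, j)` in `E^{⊗ d}` when `2j ≤ d`. -/
lemma exists_highest_weight (d j : ℕ) (h : 2 * j ≤ d) :
    ∃ x : ⨂[Qv]^d E, x ≠ 0 ∧ IsWeight (rhoD d) (d - j) j x ∧ rhoD d (gl .e) x = 0 := by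
  induction d using Nat.strong_induction_on generalizing j with
  | _ d ih =>
  rcases d with _ | d
  · obtain rfl : j = 0 := by omega
    refine ⟨PiTensorProduct.tprod Qv Fin.elim0, ?_, ⟨?_, ?_⟩, ?_⟩
    · intro h0
      have := congrArg (PiTensorProduct.isEmptyEquiv (R := Qv) (s := fun _ => E) (Fin 0)) h0
      simp at this
    all_goals simp [rhoD, counit, counitGen]
  · rcases Nat.eq_zero_or_pos j with rfl | hj
    -- For j = 0, append e₁ to the highest weight vector one degree lower.
    · obtain ⟨x, hx, hw, he⟩ := ih d (Nat.lt_succ_self d) 0 (by omega)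
      refine ⟨snoc x (Pi.single 0 1), ?_, hw.snoc isWeight_rho_zero, ?_⟩
      · intro h0
        have := congrArg (contract 0) h0
        rw [contract_snoc, map_zero] at this
        simp [hx] at this
      · rw [rhoD_e_snoc, he, rho_e_zero]
        simp [snoc]
    · obtain _ | d := d
      · omega
      obtain _ | j := j
      · omega
      obtain ⟨x, hx, hw, he⟩ := ih d (by omega) j (by omega)
      have h01 := (hw.snoc isWeight_rho_zero).snoc isWeight_rho_one
      have h10 := (hw.snoc isWeight_rho_one).snoc isWeight_rho_zero
      have e1 : d - j + 1 + 0 = d + 1 + 1 - (j + 1) := by omega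
      have e2 : d - j + 0 + 1 = d + 1 + 1 - (j + 1) := by omega
      rw [e1] at h01
      rw [e2] at h10
      -- The vector x ⊗ (e₁ ⊗ e₂ - v e₂ ⊗ e₁): its last two factors form the quantum determinant
      -- vector, which e kills because K e₁ = v e₁. Nonvanishing follows by contracting with the
      -- coordinates of e₁ ⊗ e₂, which returns x.
      refine ⟨snoc (snoc x (Pi.single 0 1)) (Pi.single 1 1) -
        v • snoc (snoc x (Pi.single 1 1)) (Pi.single 0 1), ?_, ⟨?_, ?_⟩, ?_⟩
      · intro h0
        have := congrArg (fun z => contract 0 (contract 1 z)) h0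
        simp [contract_snoc, hx] at this
      · rw [map_sub, map_smul, h01.K1, h10.K1, smul_sub, smul_comm]
      · rw [map_sub, map_smul, h01.K2, h10.K2, smul_sub, smul_comm]
      · have k0 : rhoD (d + 1) (gl .K1) (rhoD (d + 1) (gl .K2inv) (snoc x (Pi.single 0 1))) =
            (v * v ^ ((d - j : ℕ) - (j : ℤ))) • snoc x (Pi.single 0 1) := by
          have := (hw.snoc isWeight_rho_zero).K
          rw [map_mul, Module.End.mul_apply] at this
          rw [this, ← zpow_one_add₀ v_ne_zero]
          congr 2; push_cast; ring
        have k1 : rhoD d (gl .K1) (rhoD d (gl .K2inv) x) = v ^ ((d - j : ℕ) - (j : ℤ)) • x := by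
          have := hw.K
          rwa [map_mul, Module.End.mul_apply] at this
        rw [map_sub, map_smul, rhoD_e_snoc, rhoD_e_snoc, rhoD_e_snoc, rhoD_e_snoc, he, rho_e_zero,
          rho_e_one, k0, k1]
        simp only [zero_snoc, snoc_zero, zero_add, add_zero, smul_snoc, smul_smul, sub_self]

/-! ### The homomorphism from the presented algebra to the quantum Schur algebra -/

lemma gl_isSlFamily :
    IsSlFamily (gl .e) (gl .f) (gl .K1 * gl .K2inv) (gl .K1inv * gl .K2) where
  k_k' := gl_isGlFamily.K_Kinv
  k'_k := gl_isGlFamily.Kinv_K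
  k_e := by
    have h1 := inv_mul_eq_of_conj (inv_ne_zero v_ne_zero) gl_isGlFamily.K2inv_K2
      gl_isGlFamily.K2_K2inv gl_isGlFamily.K2_e
    have h2 := mul_eq_of_conj gl_isGlFamily.K1inv_K1 gl_isGlFamily.K1_e
    rw [mul_assoc, h1, mul_smul_comm, ← mul_assoc, h2, smul_mul_assoc, smul_smul, mul_assoc,
      inv_inv, zpow_two]
  k_f := by
    rw [gl_isGlFamily.K_f, zpow_neg, zpow_two, mul_inv]
  e_f := gl_isGlFamily.e_f

/-- The images of the generators of the presented algebra in `U_v(gl₂)`. -/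
def slToGl : SlGen → U
  | .e => gl .e
  | .f => gl .f
  | .K => gl .K1 * gl .K2inv
  | .Kinv => gl .K1inv * gl .K2

lemma aeval_rhoD_apply {d a b : ℕ} (hab : a + b = d) {x : ⨂[Qv]^d E}
    (hx : IsWeight (rhoD d) a b x) (p : Polynomial Qv) :
    Polynomial.aeval (rhoD d (gl .K1 * gl .K2inv)) p x = p.eval (node d b) • x := by
  apply Module.End.aeval_apply_of_mem_apply_eq_smul
  -- Here a - b = d - 2b, since a + b = d.
  rw [hx.K, node]; congr 2; omega

lemma aeval_rhoD_nodal (d : ℕ) :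
    Polynomial.aeval (rhoD d (gl .K1 * gl .K2inv))
      (Lagrange.nodal (Finset.range (d + 1)) (node d)) = 0 := by
  refine LinearMap.ext_on (span_isWeight d) ?_
  rintro x ⟨a, b, hab, hx⟩
  rw [aeval_rhoD_apply hab hx, Lagrange.eval_nodal_at_node (Finset.mem_range.2 (by omega))]
  simp

/-- The action of the presented algebra on `E^{⊗ d}`. -/
def presentedRep (d : ℕ) : Presented d →ₐ[Qv] Module.End Qv (⨂[Qv]^d E) :=
  RingQuot.liftAlgHom Qv ⟨FreeAlgebra.lift Qv fun g => rhoD d (slToGl g), by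
    have H : IsSlFamily (A := Module.End Qv (⨂[Qv]^d E)) (rhoD d (slToGl .e))
        (rhoD d (slToGl .f)) (rhoD d (slToGl .K)) (rhoD d (slToGl .Kinv)) :=
      gl_isSlFamily.map (B := Module.End Qv (⨂[Qv]^d E)) (rhoD d)
    intro x y hxy
    cases hxy
    · simpa only [map_mul, map_one, FreeAlgebra.lift_ι_apply] using H.k_k'
    · simpa only [map_mul, map_one, FreeAlgebra.lift_ι_apply] using H.k'_k
    · simp only [map_mul, map_smul, FreeAlgebra.lift_ι_apply]
      rw [H.k_e, smul_mul_assoc, mul_assoc, H.k_k', mul_one]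
      norm_cast
    · simp only [map_mul, map_smul, FreeAlgebra.lift_ι_apply]
      rw [H.k_f, smul_mul_assoc, mul_assoc, H.k_k', mul_one]
    · simpa only [map_mul, map_sub, map_smul, FreeAlgebra.lift_ι_apply] using H.e_f
    · rw [← aeval_nodal, ← Polynomial.aeval_algHom_apply, FreeAlgebra.lift_ι_apply, map_zero]
      exact aeval_rhoD_nodal d⟩

lemma presentedRep_sl (d : ℕ) (g : SlGen) : presentedRep d (sl d g) = rhoD d (slToGl g) := by
  simp [presentedRep, sl]

lemma presentedRep_mem (d : ℕ) (p : Presented d) : presentedRep d p ∈ SchurAlgebra d := by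
  obtain ⟨w, rfl⟩ := RingQuot.mkAlgHom_surjective Qv (SlRel d) p
  refine ⟨FreeAlgebra.lift Qv slToGl w, ?_⟩
  have : (rhoD d).comp (FreeAlgebra.lift Qv slToGl) =
      (presentedRep d).comp (RingQuot.mkAlgHom Qv (SlRel d)) := by
    refine FreeAlgebra.hom_ext (funext fun g => ?_)
    simp only [Function.comp_apply, AlgHom.comp_apply, FreeAlgebra.lift_ι_apply]
    exact (presentedRep_sl d g).symm
  exact DFunLike.congr_fun this w

/-- The canonical homomorphism from the presented algebra to the quantum Schur algebra. -/
def presentedToSchur (d : ℕ) : Presented d →ₐ[Qv] SchurAlgebra d :=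
  (presentedRep d).codRestrict (SchurAlgebra d) (presentedRep_mem d)

lemma presentedToSchur_sl (d : ℕ) (g : SlGen) :
    presentedToSchur d (sl d g) = toSchur d (slToGl g) :=
  Subtype.ext (presentedRep_sl d g)

/-! ### Surjectivity -/

lemma algHom_mem_of_generators {B : Type*} [Semiring B] [Algebra Qv B] (φ : U →ₐ[Qv] B)
    (S : Subalgebra Qv B) (h : ∀ g, φ (gl g) ∈ S) (u : U) : φ u ∈ S := by
  obtain ⟨w, rfl⟩ := RingQuot.mkAlgHom_surjective Qv GlRel u
  induction w using FreeAlgebra.induction with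
  | grade0 r => rw [AlgHom.commutes, AlgHom.commutes]; exact S.algebraMap_mem r
  | grade1 g => exact h g
  | mul x y hx hy => rw [map_mul, map_mul]; exact S.mul_mem hx hy
  | add x y hx hy => rw [map_add, map_add]; exact S.add_mem hx hy

lemma presentedToSchur_surjective (d : ℕ) : Function.Surjective (presentedToSchur d) := by
  -- A generator acting on each weight space by a scalar depending only on b is the polynomial in K
  -- that interpolates these scalars at the nodes.
  have key : ∀ (g : GlGen) (c : ℕ → Qv),
      (∀ a b x, a + b = d → IsWeight (rhoD d) a b x → rhoD d (gl g) x = c b • x) →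
      toSchur d (gl g) ∈ (presentedToSchur d).range := by
    intro g c hc
    refine ⟨Polynomial.aeval (sl d .K) (Lagrange.interpolate (Finset.range (d + 1)) (node d) c),
      Subtype.ext ?_⟩
    change presentedRep d (Polynomial.aeval (sl d .K) _) = rhoD d (gl g)
    rw [← Polynomial.aeval_algHom_apply, presentedRep_sl]
    change Polynomial.aeval (rhoD d (gl .K1 * gl .K2inv)) _ = rhoD d (gl g)
    refine LinearMap.ext_on (span_isWeight d) ?_
    rintro x ⟨a, b, hab, hx⟩
    rw [aeval_rhoD_apply hab hx, hc a b x hab hx, Lagrange.eval_interpolate_at_node c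
      (node_injective d).injOn (Finset.mem_range.2 (by omega))]
  rintro ⟨_, u, rfl⟩
  refine algHom_mem_of_generators (toSchur d) (presentedToSchur d).range (fun g => ?_) u
  cases g with
  | e => exact ⟨sl d .e, presentedToSchur_sl d .e⟩
  | f => exact ⟨sl d .f, presentedToSchur_sl d .f⟩
  | K1 =>
    refine key _ (fun b => v ^ ((d - b : ℕ) : ℤ)) ?_
    rintro a b x rfl hx
    simpa using hx.K1
  | K1inv =>
    refine key _ (fun b => v ^ (-((d - b : ℕ) : ℤ))) ?_
    rintro a b x rfl hx
    simpa using hx.K1inv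
  | K2 =>
    refine key _ (fun b => v ^ (b : ℤ)) ?_
    rintro a b x rfl hx
    exact hx.K2
  | K2inv =>
    refine key _ (fun b => v ^ (-(b : ℤ))) ?_
    rintro a b x rfl hx
    exact hx.K2inv

/-! ### Injectivity -/

section Action

variable {d : ℕ} {V : Type*} [AddCommGroup V] [Module Qv V]
  {π : Presented d →ₐ[Qv] Module.End Qv V} {m : ℤ} {x : V}

lemma idem_apply_eq_zero {i : ℕ} (hi : i ≤ d) (hm : m ≠ i)
    (hx : π (sl d .K) x = v ^ ((d : ℤ) - 2 * m) • x) : π (idem d i) x = 0 := by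
  have h1 : v ^ ((d : ℤ) - 2 * (i : ℤ)) • π (idem d i) x =
      v ^ ((d : ℤ) - 2 * m) • π (idem d i) x := by
    rw [← LinearMap.smul_apply, ← map_smul π, ← K_idem hi, ← idem_K_comm, map_mul,
      Module.End.mul_apply, hx, map_smul]
  exact eq_zero_of_v_zpow_smul_eq (by omega) h1

lemma idem_apply_eq_self {i : ℕ} (hi : i ≤ d)
    (hx : π (sl d .K) x = v ^ ((d : ℤ) - 2 * (i : ℤ)) • x) : π (idem d i) x = x := by
  have h := LinearMap.congr_fun (congrArg π (sum_idem d)) x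
  rw [map_sum, LinearMap.sum_apply, map_one, Module.End.one_apply, Finset.sum_eq_single i] at h
  · exact h
  · intro l hl hli
    exact idem_apply_eq_zero (by simpa [Nat.lt_succ_iff] using hl) (by omega) hx
  · intro h; simp [hi] at h

/-- The ideal generated by the idempotents of weights higher than that of a highest weight vector
annihilates the representation generated by this vector. -/
lemma idemIdeal_apply_eq_zero {j : ℕ} (hj : j ≤ d) {w : V}
    (hw : π (sl d .K) w = v ^ ((d : ℤ) - 2 * (j : ℤ)) • w) (he : π (sl d .e) w = 0)
    {y : Presented d} (hy : y ∈ idemIdeal d j) (z : Presented d) : π y (π z w) = 0 := by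
  have H := (sl_isSlFamily d).map π
  set N := Submodule.span Qv (Set.range fun a : ℕ => (π (sl d .f) ^ a) w)
  have mem : ∀ a : ℕ, (π (sl d .f) ^ a) w ∈ N := fun a => Submodule.subset_span ⟨a, rfl⟩
  have hN : ∀ p : Presented d, ∀ x ∈ N, π p x ∈ N := by
    refine stable_of_generators π fun g x hx => ?_
    refine (Submodule.span_le (p := N.comap (π (sl d g)))).2 ?_ hx
    rintro _ ⟨a, rfl⟩
    change π (sl d g) ((π (sl d .f) ^ a) w) ∈ N
    have hK := H.k_f_pow_apply hw a
    cases g with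
    | e =>
      cases a with
      | zero => simp [he]
      | succ a => rw [H.e_f_pow hw he]; exact N.smul_mem _ (mem a)
    | f => rw [← Module.End.mul_apply, ← pow_succ']; exact mem _
    | K => rw [hK]; exact N.smul_mem _ (mem a)
    | Kinv => rw [H.k'_apply hK]; exact N.smul_mem _ (mem a)
  -- The weight indices j + a occurring in `N` are all at least j.
  have h0 : ∀ i < j, ∀ x ∈ N, π (idem d i) x = 0 := by
    intro i hi x hx
    refine (Submodule.span_le (p := LinearMap.ker (π (idem d i)))).2 ?_ hx
    rintro _ ⟨a, rfl⟩
    refine idem_apply_eq_zero (m := j + a) (by omega) (by omega) ?_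
    rw [H.k_f_pow_apply hw a]
    congr 2; ring
  have hy' : ∀ x ∈ N, π y x = 0 := by
    intro x hx
    refine (Submodule.span_le
      (p := LinearMap.ker (LinearMap.applyₗ x ∘ₗ π.toLinearMap))).2 ?_ hy
    rintro _ ⟨i, hi, s, t, rfl⟩
    change π (s * idem d i * t) x = 0
    rw [map_mul, map_mul, Module.End.mul_apply, Module.End.mul_apply, h0 i hi _ (hN t x hx),
      map_zero]
  exact hy' _ (hN z w (by simpa using mem 0))

/-- An element of `idemIdeal d (j + 1)` which annihilates a representation containing a highest
weight vector of weight `d - 2j` lies in `idemIdeal d j`. -/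
lemma mem_idemIdeal_of_apply_eq_zero {j : ℕ} (hj : j ≤ d)
    (hV : 2 * j ≤ d → ∃ w : V, w ≠ 0 ∧
      π (sl d .K) w = v ^ ((d : ℤ) - 2 * (j : ℤ)) • w ∧ π (sl d .e) w = 0)
    {x : Presented d} (hx : x ∈ idemIdeal d (j + 1)) (hx0 : π x = 0) : x ∈ idemIdeal d j := by
  obtain ⟨y, hy, z, hz, rfl⟩ := Submodule.mem_sup.1 (idemIdeal_succ_le hj hx)
  obtain ⟨c, rfl⟩ := (Submodule.mem_span_range_iff_exists_fun Qv).1 hz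
  suffices hc : ∀ p, c p = 0 by simpa [hc] using hy
  rintro ⟨⟨a, ha⟩, ⟨b, hb⟩⟩
  -- The existence of an index a < d + 1 - 2j forces 2j ≤ d.
  obtain ⟨w, hw0, hw, he⟩ := hV (by omega)
  have H := (sl_isSlFamily d).map π
  obtain ⟨r, hr, hrw⟩ := H.exists_e_pow_f_pow hw he (a := a) (by omega)
  obtain ⟨s, hs, hsw⟩ := H.exists_e_pow_f_pow hw he (a := b) (by omega)
  have hfa : (π (sl d .f) ^ a) w ≠ 0 := by
    intro h
    rw [h, map_zero] at hrw
    exact smul_ne_zero hr hw0 hrw.symm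
  -- Evaluating at f^b w and projecting to the weight of f^a w isolates the coefficient at (a, b):
  -- 1_j kills e^b' f^b w unless b' = b, and the projection then forces a' = a.
  have h1 := congrArg (π (idem d (j + a))) (LinearMap.congr_fun hx0 ((π (sl d .f) ^ b) w))
  have h2 : π y ((π (sl d .f) ^ b) w) = 0 := by
    rw [← map_pow]
    exact idemIdeal_apply_eq_zero hj hw he hy _
  have h3 : ∀ a' b' : ℕ, π (idem d (j + a))
      (π (sl d .f ^ a' * idem d j * sl d .e ^ b') ((π (sl d .f) ^ b) w)) =
      if a' = a ∧ b' = b then s • (π (sl d .f) ^ a) w else 0 := by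
    intro a' b'
    have hK := H.k_e_pow_apply (H.k_f_pow_apply hw b) b'
    simp only [map_mul, map_pow, Module.End.mul_apply]
    by_cases hb' : b' = b
    · subst hb'
      rw [hsw, map_smul, idem_apply_eq_self hj hw, map_smul, map_smul]
      have hK' := H.k_f_pow_apply hw a'
      by_cases ha' : a' = a
      · subst ha'
        rw [if_pos ⟨rfl, rfl⟩, idem_apply_eq_self (by omega)]
        rw [hK']; congr 2; push_cast; ring
      · rw [if_neg (by tauto), idem_apply_eq_zero (m := j + a') (by omega) (by push_cast; omega),
          smul_zero]
        rw [hK']; congr 2; ring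
    · rw [if_neg (by tauto), idem_apply_eq_zero (m := j + b - b') hj (by omega), map_zero, map_zero]
      rw [hK]; congr 2; ring
  rw [map_add, LinearMap.add_apply, h2, zero_add, map_sum, LinearMap.sum_apply, map_sum,
    Finset.sum_eq_single (⟨a, ha⟩, ⟨b, hb⟩)] at h1
  · rw [map_smul, LinearMap.smul_apply, map_smul, h3, if_pos ⟨rfl, rfl⟩, LinearMap.zero_apply,
      map_zero, smul_eq_zero] at h1
    exact h1.resolve_right (smul_ne_zero hs hfa)
  · rintro ⟨⟨a', ha'⟩, ⟨b', hb'⟩⟩ - hne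
    rw [map_smul, LinearMap.smul_apply, map_smul, h3, if_neg, smul_zero]
    rintro ⟨rfl, rfl⟩
    exact hne rfl
  · intro h; exact absurd (Finset.mem_univ _) h

end Action

lemma presentedRep_injective (d : ℕ) : Function.Injective (presentedRep d) := by
  rw [injective_iff_map_eq_zero]
  intro x hx
  -- Here j counts the steps down from the whole algebra to the zero ideal.
  have h : ∀ j ≤ d + 1, x ∈ idemIdeal d (d + 1 - j) := by
    intro j hj
    induction j with
    | zero => exact mem_idemIdeal_succ_self d x
    | succ j ih =>
      refine mem_idemIdeal_of_apply_eq_zero (π := presentedRep d) (by omega) (fun hjd => ?_)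
        ?_ hx
      · obtain ⟨w, hw0, hw, he⟩ := exists_highest_weight d (d + 1 - (j + 1)) hjd
        refine ⟨w, hw0, ?_, ?_⟩
        · rw [presentedRep_sl]
          refine hw.K.trans ?_
          congr 2; omega
        · rw [presentedRep_sl]; exact he
      · have := ih (by omega)
        rwa [show d + 1 - j = d + 1 - (j + 1) + 1 by omega] at this
  have := h (d + 1) le_rfl
  rwa [Nat.sub_self, idemIdeal_zero, Submodule.mem_bot] at this

lemma presentedToSchur_bijective (d : ℕ) : Function.Bijective (presentedToSchur d) := by
  refine ⟨fun x y hxy => presentedRep_injective d ?_, presentedToSchur_surjective d⟩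
  exact congrArg (SchurAlgebra d).val hxy

end QSchur

end

theorem theorem2p1 (d : ℕ) :
    ∃ φ : QSchur.Presented d ≃ₐ[QSchur.Qv] QSchur.SchurAlgebra d,
      φ (QSchur.sl d .e) = QSchur.toSchur d (QSchur.gl .e) ∧
      φ (QSchur.sl d .f) = QSchur.toSchur d (QSchur.gl .f) ∧
      φ (QSchur.sl d .K) = QSchur.toSchur d (QSchur.gl .K1 * QSchur.gl .K2inv) ∧
      φ (QSchur.sl d .Kinv) = QSchur.toSchur d (QSchur.gl .K1inv * QSchur.gl .K2) :=
  ⟨AlgEquiv.ofBijective (QSchur.presentedToSchur d) (QSchur.presentedToSchur_bijective d),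
    QSchur.presentedToSchur_sl d .e, QSchur.presentedToSchur_sl d .f,
    QSchur.presentedToSchur_sl d .K, QSchur.presentedToSchur_sl d .Kinv⟩
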